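/- Let $d \in \mathbb N_0$. For a multiindex $\beta = (\beta_1,\dots,\beta_d) \in \mathbb N_0^d$ write $\partial^\beta = \frac{\partial^{\beta_1}}{\partial x_1^{\beta_1}} \cdots \frac{\partial^{\beta_d}}{\partial x_d^{\beta_d}}$. For $\gamma \in (\mathbb N_0 \cup \{\infty\})^d$ write $\beta \le \gamma$ if $\beta_i \le \gamma_i$ for all $i$, and let $\mathcal C^\gamma(\mathbb R^d)$ be the set of functions $f : \mathbb R^d \to \mathbb R$ such that, for every multiindex $\beta \le \gamma$, the derivative $\partial^\beta f$ exists and is continuous on $\mathbb R^d$. 1. Let $\gamma \in (\mathbb N_0 \cup \{\infty\})^d$ and $f \in \mathcal C^\gamma(\mathbb R^d)$. Then there is one sequence $(q_n)_{n \in \mathbb N}$ of polynomials in $d$ variables with rational coefficients such that, for every multiindex $\beta \le \gamma$, $\partial^\beta q_n \to \partial^\beta f$ locally uniformly on $\mathbb R^d$ as $n \to \infty$. 2. In particular, if $f : \mathbb R^d \to \mathbb R$ is smooth, then there is one sequence $(q_n)_{n \in \mathbb N}$ of polynomials in $d$ variables with rational coefficients such that, for every compact $K \subset \mathbb R^d$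 and every multiindex $\beta \in \mathbb N_0^d$, $\partial^\beta q_n \to \partial^\beta f$ uniformly on $K$ as $n \to \infty$. -/

import Mathlib

open Filter Topology
open scoped ContDiff

/-!  Points of `ℝ^d` are functions `Fin d → ℝ`; only the topology and the uniform structure of
`ℝ^d` matter below, and these do not depend on the choice of a norm. -/

/-- The partial derivative `∂f/∂x_i : ℝ^d → ℝ` (with the junk value `0` where it does not exist). -/
noncomputable def partialDeriv {d : ℕ} (i : Fin d) (f : (Fin d → ℝ) → ℝ) : (Fin d → ℝ) → ℝ :=
  fun x => lineDeriv ℝ f x (Pi.single i 1)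

/-- The iterated partial derivative `∂_{i₁} (∂_{i₂} (⋯ (∂_{i_k} f)))` along a list `[i₁, …, i_k]` of
coordinate directions. -/
noncomputable def partialDerivList {d : ℕ} (f : (Fin d → ℝ) → ℝ) :
    List (Fin d) → ((Fin d → ℝ) → ℝ)
  | [] => f
  | i :: w => partialDeriv i (partialDerivList f w)

/-- `∂_{i₁} (∂_{i₂} (⋯ (∂_{i_k} f)))` exists everywhere on `ℝ^d`: every one of the successive partial
derivatives exists at every point. -/
def PartialDerivListExists {d : ℕ} (f : (Fin d → ℝ) → ℝ) : List (Fin d) → Prop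
  | [] => True
  | i :: w => PartialDerivListExists f w ∧
      ∀ x : Fin d → ℝ, LineDifferentiableAt ℝ (partialDerivList f w) x (Pi.single i 1)

/-- The list `[0, …, 0, 1, …, 1, …, d-1, …, d-1]` in which the coordinate `i` occurs `β i` times. -/
def multiIndexList {d : ℕ} (β : Fin d → ℕ) : List (Fin d) :=
  (List.finRange d).flatMap fun i => List.replicate (β i) i

/-- `∂^β f = (∂/∂x₁)^{β₁} ⋯ (∂/∂x_d)^{β_d} f` for a multiindex `β`. -/
noncomputable def multiPartialDeriv {d : ℕ} (β : Fin d → ℕ) (f : (Fin d → ℝ) → ℝ) :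
    (Fin d → ℝ) → ℝ :=
  partialDerivList f (multiIndexList β)

/-- The class `C^γ(ℝ^d)`, where the entries of `γ` may be infinite: for every multiindex `β ≤ γ` the
derivative `∂^β f` exists on `ℝ^d` and is continuous. -/
def IsCMulti {d : ℕ} (γ : Fin d → ℕ∞) (f : (Fin d → ℝ) → ℝ) : Prop :=
  ∀ β : Fin d → ℕ, (∀ i, (β i : ℕ∞) ≤ γ i) →
    PartialDerivListExists f (multiIndexList β) ∧ Continuous (multiPartialDeriv β f)

/-- The function `ℝ^d → ℝ` given by a polynomial with rational coefficients. -/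
noncomputable def ratPolyFun {d : ℕ} (q : MvPolynomial (Fin d) ℚ) : (Fin d → ℝ) → ℝ :=
  fun x => MvPolynomial.aeval x q

/-! It is enough to approximate finitely many derivatives on one closed ball with a given error; a
diagonal choice then gives the sequence. Mollification reduces this to smooth functions: a
continuous function is close on balls to its convolution with a narrow bump, and
`partialDerivList_convolution` moves the derivatives onto `f`, since each intermediate derivative is
itself some `∂^β f` with `β ≤ γ`. A smooth function is cut off to a compactly supported `g`. If a
polynomial `p` is uniformly close to a bump `φ` (Stone–Weierstrass), then `p ⋆ g` is again a
polynomial, and `∂^w (p ⋆ g) = p ⋆ ∂^w g` is close to `φ ⋆ ∂^w g`, hence to `∂^w g`. Thus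
approximation in sup norm alone controls all the derivatives. Finally the coefficients are perturbed
to rationals. -/

open MeasureTheory Metric
open scoped Convolution

/-! ### Calculus of iterated partial derivatives of smooth functions -/

section PartialDerivatives

variable {d : ℕ}

lemma partialDeriv_eq_fderiv {f : (Fin d → ℝ) → ℝ} (hf : Differentiable ℝ f) (i : Fin d) :
    partialDeriv i f = fun x => fderiv ℝ f x (Pi.single i 1) :=
  funext fun x => (hf x).lineDeriv_eq_fderiv

lemma ContDiff.contDiff_partialDeriv {f : (Fin d → ℝ) → ℝ} (hf : ContDiff ℝ ∞ f) (i : Fin d) :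
    ContDiff ℝ ∞ (partialDeriv i f) := by
  rw [partialDeriv_eq_fderiv (hf.differentiable (by simp))]
  exact (hf.fderiv_right (m := ∞) (by simp)).clm_apply contDiff_const

lemma ContDiff.contDiff_partialDerivList {f : (Fin d → ℝ) → ℝ}
    (hf : ContDiff ℝ ∞ f) (w : List (Fin d)) : ContDiff ℝ ∞ (partialDerivList f w) := by
  induction w with
  | nil => exact hf
  | cons i w ih => exact ih.contDiff_partialDeriv i

lemma ContDiff.partialDerivListExists {f : (Fin d → ℝ) → ℝ} (hf : ContDiff ℝ ∞ f)
    (w : List (Fin d)) : PartialDerivListExists f w := by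
  induction w with
  | nil => trivial
  | cons i w ih =>
    exact ⟨ih, fun x =>
      ((hf.contDiff_partialDerivList w).differentiable (by simp) x).lineDifferentiableAt⟩

lemma ContDiff.isCMulti {f : (Fin d → ℝ) → ℝ} (hf : ContDiff ℝ ∞ f) (γ : Fin d → ℕ∞) :
    IsCMulti γ f := fun β _ =>
  ⟨hf.partialDerivListExists _, (hf.contDiff_partialDerivList (multiIndexList β)).continuous⟩

lemma partialDerivList_add {f g : (Fin d → ℝ) → ℝ} (hf : ContDiff ℝ ∞ f) (hg : ContDiff ℝ ∞ g)
    (w : List (Fin d)) :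
    partialDerivList (fun x => f x + g x) w =
      fun x => partialDerivList f w x + partialDerivList g w x := by
  induction w with
  | nil => rfl
  | cons i w ih =>
    have hf' := (hf.contDiff_partialDerivList w).differentiable (by simp)
    have hg' := (hg.contDiff_partialDerivList w).differentiable (by simp)
    rw [partialDerivList, ih, partialDeriv_eq_fderiv (hf'.fun_add hg')]
    ext x
    rw [fderiv_fun_add (hf' x) (hg' x), partialDerivList, partialDerivList,
      partialDeriv_eq_fderiv hf', partialDeriv_eq_fderiv hg']
    rfl

lemma partialDerivList_const_mul {f : (Fin d → ℝ) → ℝ} (hf : ContDiff ℝ ∞ f) (c : ℝ)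
    (w : List (Fin d)) :
    partialDerivList (fun x => c * f x) w = fun x => c * partialDerivList f w x := by
  induction w with
  | nil => rfl
  | cons i w ih =>
    have hf' := (hf.contDiff_partialDerivList w).differentiable (by simp)
    rw [partialDerivList, ih, partialDeriv_eq_fderiv (hf'.const_mul c)]
    ext x
    rw [fderiv_const_mul (hf' x), partialDerivList, partialDeriv_eq_fderiv hf']
    rfl

lemma partialDerivList_eventuallyEq {f g : (Fin d → ℝ) → ℝ} {x : Fin d → ℝ} (h : f =ᶠ[𝓝 x] g)
    (w : List (Fin d)) : partialDerivList f w =ᶠ[𝓝 x] partialDerivList g w := by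
  induction w with
  | nil => exact h
  | cons i w ih => exact ih.eventuallyEq_nhds.mono fun y hy => hy.lineDeriv_eq

lemma HasCompactSupport.hasCompactSupport_partialDerivList {f : (Fin d → ℝ) → ℝ}
    (hs : HasCompactSupport f) (hf : ContDiff ℝ ∞ f) (w : List (Fin d)) :
    HasCompactSupport (partialDerivList f w) := by
  induction w with
  | nil => exact hs
  | cons i w ih =>
    rw [partialDerivList,
      partialDeriv_eq_fderiv ((hf.contDiff_partialDerivList w).differentiable (by simp))]
    exact ih.fderiv_apply ℝ _

end PartialDerivatives

/-! ### Sorted lists of directions -/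

section MultiIndexLists

variable {d : ℕ}

lemma count_multiIndexList (β : Fin d → ℕ) (i : Fin d) : (multiIndexList β).count i = β i := by
  rw [multiIndexList, List.count_flatMap]
  have h : (List.count i ∘ fun j => List.replicate (β j) j) = fun j => if j = i then β j else 0 := by
    ext j
    simp [List.count_replicate]
  rw [h, ← List.ofFn_eq_map, List.sum_ofFn]
  simp

lemma pairwise_multiIndexList (β : Fin d → ℕ) : (multiIndexList β).Pairwise (· ≤ ·) := by
  rw [multiIndexList, List.pairwise_flatMap]
  refine ⟨fun i _ => by simp [List.pairwise_replicate], (List.pairwise_lt_finRange d).imp ?_⟩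
  intro a b hab x hx y hy
  rw [List.eq_of_mem_replicate hx, List.eq_of_mem_replicate hy]
  exact hab.le

/-- Sorted lists with equal counts coincide. Hence every intermediate stage in computing `∂^β f` is
an ordered derivative of smaller multiindex, and `IsCMulti` applies to it. -/
lemma List.Sublist.eq_multiIndexList {β : Fin d → ℕ} {w : List (Fin d)}
    (h : w.Sublist (multiIndexList β)) :
    w = multiIndexList fun i => w.count i := by
  refine List.Perm.eq_of_pairwise' ((pairwise_multiIndexList β).sublist h)
    (pairwise_multiIndexList _) (List.perm_iff_count.2 fun i => ?_)
  rw [count_multiIndexList]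

lemma IsCMulti.continuous_of_suffix {γ : Fin d → ℕ∞} {f : (Fin d → ℝ) → ℝ} (hf : IsCMulti γ f)
    {β : Fin d → ℕ} (hβ : ∀ i, (β i : ℕ∞) ≤ γ i) {w : List (Fin d)}
    (hw : w <:+ multiIndexList β) : Continuous (partialDerivList f w) := by
  have hle : ∀ i, ((w.count i : ℕ) : ℕ∞) ≤ γ i := fun i =>
    le_trans (by exact_mod_cast (hw.sublist.count_le i).trans_eq (count_multiIndexList β i)) (hβ i)
  have h := (hf _ hle).2
  rwa [multiPartialDeriv, ← hw.sublist.eq_multiIndexList] at h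

end MultiIndexLists

/-! ### Mollification -/

section Convolution

variable {d : ℕ}

/-- Differentiation under the integral sign. Only one directional derivative of `g` is available, so
Fréchet differentiability cannot be used. -/
lemma HasCompactSupport.hasLineDerivAt_convolution {φ g h : (Fin d → ℝ) → ℝ}
    (hs : HasCompactSupport φ) (hφ : Continuous φ) (hg : Continuous g) (hh : Continuous h)
    {v : Fin d → ℝ} (hgh : ∀ x, HasLineDerivAt ℝ g (h x) x v) (x : Fin d → ℝ) :
    HasLineDerivAt ℝ (φ ⋆[ContinuousLinearMap.lsmul ℝ ℝ, volume] g)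
      ((φ ⋆[ContinuousLinearMap.lsmul ℝ ℝ, volume] h) x) x v := by
  have hK : IsCompact ((fun p : ℝ × (Fin d → ℝ) => x + p.1 • v - p.2) ''
      (closedBall (0 : ℝ) 1 ×ˢ tsupport φ)) :=
    ((isCompact_closedBall _ _).prod hs).image (by fun_prop)
  obtain ⟨C, hC⟩ := hK.exists_bound_of_continuousOn hh.continuousOn
  have hint : ∀ k : (Fin d → ℝ) → ℝ, Continuous k → ∀ t : ℝ,
      Integrable (fun y => φ y * k (x + t • v - y)) := fun k hk t =>
    (hφ.mul (hk.comp (by fun_prop))).integrable_of_hasCompactSupport hs.mul_right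
  have key := (hasDerivAt_integral_of_dominated_loc_of_deriv_le (μ := volume) (x₀ := (0 : ℝ))
    (s := ball 0 1) (F := fun t y => φ y * g (x + t • v - y))
    (F' := fun t y => φ y * h (x + t • v - y)) (bound := fun y => ‖φ y‖ * C)
    (ball_mem_nhds _ one_pos)
    (Eventually.of_forall fun t => (hint g hg t).aestronglyMeasurable) (hint g hg 0)
    (hint h hh 0).aestronglyMeasurable
    (Eventually.of_forall fun y t ht => ?_)
    ((hφ.norm.integrable_of_hasCompactSupport hs.norm).mul_const C)
    (Eventually.of_forall fun y t _ => ?_)).2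
  · simpa [HasLineDerivAt, convolution_def] using key
  · rw [norm_mul]
    by_cases hy : y ∈ tsupport φ
    · exact mul_le_mul_of_nonneg_left
        (hC _ ⟨(t, y), ⟨ball_subset_closedBall ht, hy⟩, rfl⟩) (norm_nonneg _)
    · simp [image_eq_zero_of_notMem_tsupport hy]
  -- The base point `0` is written `t - t` so that the shift `s ↦ s - t` can be composed in.
  · have h0 : HasDerivAt (fun s : ℝ => g (x + t • v - y + s • v)) (h (x + t • v - y)) (t - t) := by
      rw [sub_self]; exact hgh _
    have h1 := (h0.comp_sub_const t t).const_mul (φ y)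
    refine h1.congr_of_eventuallyEq (Eventually.of_forall fun s => ?_)
    have : x + s • v - y = x + t • v - y + (s - t) • v := by rw [sub_smul]; abel
    simp only [this]

lemma partialDerivList_convolution {φ f : (Fin d → ℝ) → ℝ} (hs : HasCompactSupport φ)
    (hφ : Continuous φ) (w : List (Fin d)) (hex : PartialDerivListExists f w)
    (hc : ∀ u, u <:+ w → Continuous (partialDerivList f u)) :
    partialDerivList (φ ⋆[ContinuousLinearMap.lsmul ℝ ℝ, volume] f) w =
      φ ⋆[ContinuousLinearMap.lsmul ℝ ℝ, volume] partialDerivList f w := by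
  induction w with
  | nil => rfl
  | cons i w ih =>
    rw [partialDerivList, ih hex.1 fun u hu => hc u (hu.trans (List.suffix_cons i w))]
    ext x
    exact (hs.hasLineDerivAt_convolution hφ (hc w (List.suffix_cons i w))
      (hc (i :: w) List.suffix_rfl) (fun y => (hex.2 y).hasLineDerivAt) x).lineDeriv

lemma partialDerivList_convolution_right {p g : (Fin d → ℝ) → ℝ} (hp : Continuous p)
    (hs : HasCompactSupport g) (hg : ContDiff ℝ ∞ g) (w : List (Fin d)) :
    partialDerivList (p ⋆[ContinuousLinearMap.lsmul ℝ ℝ, volume] g) w =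
      p ⋆[ContinuousLinearMap.lsmul ℝ ℝ, volume] partialDerivList g w := by
  induction w with
  | nil => rfl
  | cons i w ih =>
    have hw := hg.contDiff_partialDerivList w
    have hsw := hs.hasCompactSupport_partialDerivList hg w
    have hw1 : ContDiff ℝ 1 (partialDerivList g w) := hw.of_le (by simp)
    rw [partialDerivList, ih]
    ext x
    rw [partialDeriv, ((hsw.hasFDerivAt_convolution_right (ContinuousLinearMap.lsmul ℝ ℝ)
      hp.locallyIntegrable hw1 x).hasLineDerivAt _).lineDeriv,
      convolution_precompR_apply _ hp.locallyIntegrable (hsw.fderiv ℝ)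
        (hw1.continuous_fderiv one_ne_zero),
      partialDerivList, partialDeriv_eq_fderiv (hw.differentiable (by simp))]

lemma Continuous.exists_forall_dist_bump_convolution_le {g : (Fin d → ℝ) → ℝ} (hg : Continuous g)
    (R : ℝ) {ε : ℝ} (hε : 0 < ε) :
    ∃ δ > 0, ∀ φ : ContDiffBump (0 : Fin d → ℝ), φ.rOut ≤ δ → ∀ x ∈ closedBall 0 R,
      dist ((φ.normed volume ⋆[ContinuousLinearMap.lsmul ℝ ℝ, volume] g) x) (g x) ≤ ε := by
  have huc := (isCompact_closedBall (0 : Fin d → ℝ) (R + 1)).uniformContinuousOn_of_continuous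
    hg.continuousOn
  obtain ⟨δ, hδ, h⟩ := Metric.uniformContinuousOn_iff.1 huc ε hε
  refine ⟨min δ 1, by positivity, fun φ hφ x hx => ?_⟩
  refine ContDiffBump.dist_normed_convolution_le hg.aestronglyMeasurable fun y hy => ?_
  have hyx : dist y x < min δ 1 := (mem_ball.1 hy).trans_le hφ
  rw [mem_closedBall] at hx
  refine (h y ?_ x ?_ (hyx.trans_le (min_le_left _ _))).le
  · rw [mem_closedBall]
    linarith [dist_triangle y x 0, hyx.trans_le (min_le_right δ 1)]
  · rw [mem_closedBall]
    linarith

lemma exists_bump_forall_dist_convolution_le {ι : Type*} (T : Finset ι)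
    {g : ι → (Fin d → ℝ) → ℝ} (hg : ∀ i ∈ T, Continuous (g i)) (R : ℝ) {ε : ℝ} (hε : 0 < ε) :
    ∃ φ : ContDiffBump (0 : Fin d → ℝ), ∀ i ∈ T, ∀ x ∈ closedBall 0 R,
      dist ((φ.normed volume ⋆[ContinuousLinearMap.lsmul ℝ ℝ, volume] g i) x) (g i x) ≤ ε := by
  have key : ∃ δ > 0, ∀ φ : ContDiffBump (0 : Fin d → ℝ), φ.rOut ≤ δ → ∀ i ∈ T,
      ∀ x ∈ closedBall 0 R,
      dist ((φ.normed volume ⋆[ContinuousLinearMap.lsmul ℝ ℝ, volume] g i) x) (g i x) ≤ ε := by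
    classical
    induction T using Finset.induction_on with
    | empty => exact ⟨1, one_pos, by simp⟩
    | insert a s _ ih =>
      obtain ⟨δ₁, h₁, H₁⟩ := ih fun i hi => hg i (Finset.mem_insert_of_mem hi)
      obtain ⟨δ₂, h₂, H₂⟩ :=
        (hg a (Finset.mem_insert_self a s)).exists_forall_dist_bump_convolution_le R hε
      refine ⟨min δ₁ δ₂, lt_min h₁ h₂, fun φ hφ i hi => ?_⟩
      rcases Finset.mem_insert.1 hi with rfl | hi
      · exact H₂ φ (hφ.trans (min_le_right _ _))
      · exact H₁ φ (hφ.trans (min_le_left _ _)) i hi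
  obtain ⟨δ, hδ, H⟩ := key
  exact ⟨⟨δ / 2, δ, half_pos hδ, half_lt_self hδ⟩, H _ le_rfl⟩

lemma IsCMulti.exists_contDiff_dist_le {γ : Fin d → ℕ∞} {f : (Fin d → ℝ) → ℝ} (hf : IsCMulti γ f)
    (T : Finset (Fin d → ℕ)) (hT : ∀ β ∈ T, ∀ i, (β i : ℕ∞) ≤ γ i) (R : ℝ) {ε : ℝ} (hε : 0 < ε) :
    ∃ F : (Fin d → ℝ) → ℝ, ContDiff ℝ ∞ F ∧ ∀ β ∈ T, ∀ x ∈ closedBall 0 R,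
      dist (multiPartialDeriv β F x) (multiPartialDeriv β f x) ≤ ε := by
  obtain ⟨φ, hφ⟩ := exists_bump_forall_dist_convolution_le T
    (g := fun β => multiPartialDeriv β f) (fun β hβ => (hf β (hT β hβ)).2) R hε
  have hf0 : Continuous f := (hf 0 (by simp)).2.congr fun x => by
    have h : multiIndexList (0 : Fin d → ℕ) = [] := by simp [multiIndexList]
    rw [multiPartialDeriv, h, partialDerivList]
  refine ⟨φ.normed volume ⋆[ContinuousLinearMap.lsmul ℝ ℝ, volume] f,
    φ.hasCompactSupport_normed.contDiff_convolution_left _ φ.contDiff_normed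
      hf0.locallyIntegrable, fun β hβ x hx => ?_⟩
  rw [multiPartialDeriv, partialDerivList_convolution φ.hasCompactSupport_normed
    φ.continuous_normed _ (hf β (hT β hβ)).1 fun u hu => hf.continuous_of_suffix (hT β hβ) hu]
  exact hφ β hβ x hx

end Convolution

/-! ### Polynomial approximation -/

section Polynomials

variable {d : ℕ}

lemma MvPolynomial.contDiff_eval (p : MvPolynomial (Fin d) ℝ) :
    ContDiff ℝ ∞ fun x : Fin d → ℝ => MvPolynomial.eval x p := by
  induction p using MvPolynomial.induction_on with
  | C a => simpa using contDiff_const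
  | add p q hp hq => simpa using hp.add hq
  | mul_X p i hp => simpa using hp.mul (contDiff_apply ℝ ℝ i)

lemma ratPolyFun_eq_eval (q : MvPolynomial (Fin d) ℚ) :
    ratPolyFun q = fun x => MvPolynomial.eval x (q.map (algebraMap ℚ ℝ)) := by
  ext x
  rw [ratPolyFun, MvPolynomial.eval_map, MvPolynomial.aeval_def]

lemma contDiff_ratPolyFun (q : MvPolynomial (Fin d) ℚ) : ContDiff ℝ ∞ (ratPolyFun q) := by
  rw [ratPolyFun_eq_eval]
  exact MvPolynomial.contDiff_eval _

lemma exists_mvPolynomial_forall_dist_le {g : (Fin d → ℝ) → ℝ} (hg : Continuous g)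
    {K : Set (Fin d → ℝ)} (hK : IsCompact K) {ε : ℝ} (hε : 0 < ε) :
    ∃ p : MvPolynomial (Fin d) ℝ, ∀ x ∈ K, dist (MvPolynomial.eval x p) (g x) ≤ ε := by
  let coord : Fin d → C(Fin d → ℝ, ℝ) := fun i => ⟨fun x => x i, continuous_apply i⟩
  have hA : ((MvPolynomial.aeval (R := ℝ) coord).range).SeparatesPoints := by
    intro x y hxy
    obtain ⟨i, hi⟩ := Function.ne_iff.1 hxy
    exact ⟨_, ⟨coord i, ⟨MvPolynomial.X i, by simp⟩, rfl⟩, hi⟩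
  obtain ⟨_, ⟨p, rfl⟩, hp⟩ :=
    ContinuousMap.exists_mem_subalgebra_near_continuous_of_isCompact_of_separatesPoints hA
      ⟨g, hg⟩ hK hε
  have heval : ∀ (q : MvPolynomial (Fin d) ℝ) (x : Fin d → ℝ),
      MvPolynomial.aeval (R := ℝ) coord q x = MvPolynomial.eval x q := by
    intro q x
    induction q using MvPolynomial.induction_on with
    | C a => simp
    | add p q hp hq => simp [hp, hq]
    | mul_X p i hp => simp [hp, coord]
  refine ⟨p, fun x hx => ?_⟩
  have := hp x hx
  rw [dist_eq_norm, ← heval]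
  exact this.le

/-- Induction on `p`: a factor `x i - y i` splits into `x i`, which leaves the integral, and `y i`,
which is absorbed into `g`; hence `g` is generalized. -/
lemma exists_eval_eq_convolution (p : MvPolynomial (Fin d) ℝ) {g : (Fin d → ℝ) → ℝ}
    (hs : HasCompactSupport g) (hg : Continuous g) :
    ∃ r : MvPolynomial (Fin d) ℝ,
      ((fun x => MvPolynomial.eval x p) ⋆[ContinuousLinearMap.lsmul ℝ ℝ, volume] g) =
        fun x => MvPolynomial.eval x r := by
  have hint : ∀ (q : MvPolynomial (Fin d) ℝ) {k : (Fin d → ℝ) → ℝ}, HasCompactSupport k →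
      Continuous k → ∀ x, Integrable fun y => MvPolynomial.eval (x - y) q * k y :=
    fun q k hk hk' x => (((q.contDiff_eval.continuous).comp (by fun_prop)).mul
      hk').integrable_of_hasCompactSupport hk.mul_left
  suffices h : ∃ r : MvPolynomial (Fin d) ℝ,
      ∀ x, ∫ y, MvPolynomial.eval (x - y) p * g y = MvPolynomial.eval x r by
    obtain ⟨r, hr⟩ := h
    refine ⟨r, funext fun x => ?_⟩
    rw [convolution_lsmul_swap, ← hr x]
    rfl
  induction p using MvPolynomial.induction_on generalizing g with
  | C a => exact ⟨MvPolynomial.C (∫ y, a * g y), fun x => by simp⟩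
  | add p q hp hq =>
    obtain ⟨r, hr⟩ := hp hs hg
    obtain ⟨s, hs'⟩ := hq hs hg
    refine ⟨r + s, fun x => ?_⟩
    simp only [map_add, add_mul]
    rw [integral_add (hint p hs hg x) (hint q hs hg x), hr, hs']
  | mul_X p i hp =>
    have hsi : HasCompactSupport fun y : Fin d → ℝ => y i * g y := hs.mul_left
    have hgi : Continuous fun y : Fin d → ℝ => y i * g y := (continuous_apply i).mul hg
    obtain ⟨r, hr⟩ := hp hs hg
    obtain ⟨s, hs'⟩ := hp hsi hgi
    refine ⟨MvPolynomial.X i * r - s, fun x => ?_⟩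
    have : ∀ y, MvPolynomial.eval (x - y) (p * MvPolynomial.X i) * g y =
        x i * (MvPolynomial.eval (x - y) p * g y) -
          MvPolynomial.eval (x - y) p * (y i * g y) := fun y => by
      simp only [map_mul, MvPolynomial.eval_X, Pi.sub_apply]
      ring
    simp_rw [this]
    rw [integral_sub ((hint p hs hg x).const_mul _) (hint p hsi hgi x), integral_const_mul, hr, hs']
    simp

lemma dist_convolution_le_of_forall_dist_le {p φ g : (Fin d → ℝ) → ℝ} (hp : Continuous p)
    (hφ : Continuous φ) (hg : Continuous g) {r R η : ℝ}
    (hsupp : tsupport g ⊆ closedBall 0 r) (hη : ∀ x ∈ closedBall 0 (R + r), dist (p x) (φ x) ≤ η)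
    {x : Fin d → ℝ} (hx : x ∈ closedBall 0 R) :
    dist ((p ⋆[ContinuousLinearMap.lsmul ℝ ℝ, volume] g) x)
      ((φ ⋆[ContinuousLinearMap.lsmul ℝ ℝ, volume] g) x) ≤ η * ∫ y, ‖g y‖ := by
  have hs : HasCompactSupport g :=
    (isCompact_closedBall _ _).of_isClosed_subset (isClosed_tsupport g) hsupp
  have hint : ∀ k : (Fin d → ℝ) → ℝ, Continuous k → Integrable fun y => k (x - y) • g y :=
    fun k hk => ((hk.comp (by fun_prop)).smul hg).integrable_of_hasCompactSupport hs.smul_left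
  rw [convolution_lsmul_swap, convolution_lsmul_swap, dist_eq_norm,
    ← integral_sub (hint p hp) (hint φ hφ), ← integral_const_mul]
  refine norm_integral_le_of_norm_le
    ((hg.norm.integrable_of_hasCompactSupport hs.norm).const_mul η)
    (Eventually.of_forall fun y => ?_)
  rw [← sub_smul, norm_smul]
  by_cases hy : y ∈ tsupport g
  · refine mul_le_mul_of_nonneg_right ?_ (norm_nonneg _)
    rw [← dist_eq_norm]
    refine hη _ ?_
    have h1 := hsupp hy
    rw [mem_closedBall_zero_iff] at h1 hx ⊢
    exact (norm_sub_le x y).trans (add_le_add hx h1)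
  · simp [image_eq_zero_of_notMem_tsupport hy]

lemma tsupport_partialDerivList_subset {f : (Fin d → ℝ) → ℝ} (hf : ContDiff ℝ ∞ f)
    (w : List (Fin d)) : tsupport (partialDerivList f w) ⊆ tsupport f := by
  induction w with
  | nil => exact subset_rfl
  | cons i w ih =>
    rw [partialDerivList,
      partialDeriv_eq_fderiv ((hf.contDiff_partialDerivList w).differentiable (by simp))]
    exact (tsupport_fderiv_apply_subset ℝ _).trans ih

lemma HasCompactSupport.exists_mvPolynomial_forall_dist_partialDerivList_le
    {g : (Fin d → ℝ) → ℝ} (hs : HasCompactSupport g) (hg : ContDiff ℝ ∞ g)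
    (T : Finset (List (Fin d))) (R : ℝ) {ε : ℝ} (hε : 0 < ε) :
    ∃ p : MvPolynomial (Fin d) ℝ, ∀ w ∈ T, ∀ x ∈ closedBall 0 R,
      dist (partialDerivList (fun y => MvPolynomial.eval y p) w x) (partialDerivList g w x) ≤ ε := by
  obtain ⟨r, hr⟩ := hs.isBounded.subset_closedBall 0
  obtain ⟨φ, hφ⟩ := exists_bump_forall_dist_convolution_le T (g := partialDerivList g)
    (fun w _ => (hg.contDiff_partialDerivList w).continuous) R (half_pos hε)
  set M := ∑ w ∈ T, ∫ y, ‖partialDerivList g w y‖ with hM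
  have hM0 : 0 ≤ M := Finset.sum_nonneg fun w _ => integral_nonneg fun y => norm_nonneg _
  -- One tolerance for all `w ∈ T`; the `+ 1` covers `M = 0`.
  have hη : 0 < ε / 2 / (M + 1) := by positivity
  obtain ⟨p, hp⟩ := exists_mvPolynomial_forall_dist_le (φ.continuous_normed (μ := volume))
    (isCompact_closedBall (0 : Fin d → ℝ) (R + r)) hη
  obtain ⟨q, hq⟩ := exists_eval_eq_convolution p hs hg.continuous
  refine ⟨q, fun w hw x hx => ?_⟩
  rw [← hq, partialDerivList_convolution_right p.contDiff_eval.continuous hs hg]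
  have h1 := dist_convolution_le_of_forall_dist_le p.contDiff_eval.continuous
    φ.continuous_normed (hg.contDiff_partialDerivList w).continuous
    ((tsupport_partialDerivList_subset hg w).trans hr) hp hx
  have h2 : ∫ y, ‖partialDerivList g w y‖ ≤ M :=
    Finset.single_le_sum (f := fun w => ∫ y, ‖partialDerivList g w y‖)
      (fun w _ => integral_nonneg fun y => norm_nonneg _) hw
  have h3 : ε / 2 / (M + 1) * ∫ y, ‖partialDerivList g w y‖ ≤ ε / 2 := by
    rw [div_mul_eq_mul_div, div_le_iff₀ (by positivity)]
    exact mul_le_mul_of_nonneg_left (by linarith) (by positivity)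
  linarith [dist_triangle
    (((fun y => MvPolynomial.eval y p) ⋆[ContinuousLinearMap.lsmul ℝ ℝ, volume]
      partialDerivList g w) x)
    ((φ.normed volume ⋆[ContinuousLinearMap.lsmul ℝ ℝ, volume] partialDerivList g w) x)
    (partialDerivList g w x), hφ w hw x hx]

lemma MvPolynomial.exists_ratPolyFun_forall_dist_partialDerivList_le
    (p : MvPolynomial (Fin d) ℝ) (T : Finset (List (Fin d))) {K : Set (Fin d → ℝ)}
    (hK : IsCompact K) {ε : ℝ} (hε : 0 < ε) :
    ∃ q : MvPolynomial (Fin d) ℚ, ∀ w ∈ T, ∀ x ∈ K,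
      dist (partialDerivList (ratPolyFun q) w x)
        (partialDerivList (fun y => MvPolynomial.eval y p) w x) ≤ ε := by
  induction p using MvPolynomial.induction_on' generalizing ε with
  | monomial u a =>
    have hm := MvPolynomial.contDiff_eval (MvPolynomial.monomial u (1 : ℝ))
    have hc : ∀ c : ℝ, (fun y : Fin d → ℝ => MvPolynomial.eval y (MvPolynomial.monomial u c)) =
        fun y => c * MvPolynomial.eval y (MvPolynomial.monomial u 1) := fun c => by
      ext y
      simp [MvPolynomial.eval_monomial]
    choose C hC using fun w => hK.exists_bound_of_continuousOn
      (hm.contDiff_partialDerivList w).continuous.continuousOn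
    have hM0 : 0 ≤ ∑ w ∈ T, |C w| := Finset.sum_nonneg fun w _ => abs_nonneg _
    obtain ⟨b, hb⟩ := (Rat.denseRange_cast (𝕜 := ℝ)).exists_dist_lt a
      (show 0 < ε / (∑ w ∈ T, |C w| + 1) by positivity)
    refine ⟨MvPolynomial.monomial u b, fun w hw x hx => ?_⟩
    rw [ratPolyFun_eq_eval, MvPolynomial.map_monomial, hc, hc a, partialDerivList_const_mul hm,
      partialDerivList_const_mul hm, Real.dist_eq, ← sub_mul, abs_mul, ← Real.dist_eq, dist_comm]
    rw [lt_div_iff₀ (by positivity)] at hb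
    refine le_trans (mul_le_mul_of_nonneg_left ?_ dist_nonneg) hb.le
    have h1 := hC w x hx
    have h2 := Finset.single_le_sum (f := fun w => |C w|) (fun w _ => abs_nonneg _) hw
    rw [Real.norm_eq_abs] at h1
    linarith [le_abs_self (C w)]
  | add p q hp hq =>
    obtain ⟨p', hp'⟩ := hp (half_pos hε)
    obtain ⟨q', hq'⟩ := hq (half_pos hε)
    refine ⟨p' + q', fun w hw x hx => ?_⟩
    have h1 : ratPolyFun (p' + q') = fun y => ratPolyFun p' y + ratPolyFun q' y := by
      ext y
      simp [ratPolyFun]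
    simp only [h1, map_add]
    rw [partialDerivList_add (contDiff_ratPolyFun p') (contDiff_ratPolyFun q'),
      partialDerivList_add p.contDiff_eval q.contDiff_eval]
    refine (dist_add_add_le _ _ _ _).trans ?_
    linarith [hp' w hw x hx, hq' w hw x hx]

lemma exists_ratPolyFun_forall_dist_partialDerivList_le_of_contDiff
    {f : (Fin d → ℝ) → ℝ}
    (hf : ContDiff ℝ ∞ f) (T : Finset (List (Fin d))) {R : ℝ} (hR : 0 ≤ R) {ε : ℝ} (hε : 0 < ε) :
    ∃ q : MvPolynomial (Fin d) ℚ, ∀ w ∈ T, ∀ x ∈ closedBall 0 R,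
      dist (partialDerivList (ratPolyFun q) w x) (partialDerivList f w x) ≤ ε := by
  -- The cutoff is `1` on a ball larger than radius `R`, so `χ * f` and `f` agree near each point of
  -- the closed ball, along with their derivatives.
  let χ : ContDiffBump (0 : Fin d → ℝ) := ⟨R + 1, R + 2, by linarith, by linarith⟩
  obtain ⟨p, hp⟩ := (χ.hasCompactSupport.mul_right
    (f' := f)).exists_mvPolynomial_forall_dist_partialDerivList_le (χ.contDiff.mul hf) T R
      (half_pos hε)
  obtain ⟨q, hq⟩ := p.exists_ratPolyFun_forall_dist_partialDerivList_le T
    (isCompact_closedBall (0 : Fin d → ℝ) R) (half_pos hε)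
  refine ⟨q, fun w hw x hx => ?_⟩
  have hloc : ⇑χ * f =ᶠ[𝓝 x] f := by
    have hx' : x ∈ ball (0 : Fin d → ℝ) χ.rIn :=
      closedBall_subset_ball (show R < R + 1 by linarith) hx
    filter_upwards [χ.eventuallyEq_one_of_mem_ball hx'] with y hy
    simp [hy]
  have h1 := hp w hw x hx
  rw [(partialDerivList_eventuallyEq hloc w).eq_of_nhds] at h1
  linarith [dist_triangle (partialDerivList (ratPolyFun q) w x)
    (partialDerivList (fun y => MvPolynomial.eval y p) w x) (partialDerivList f w x),
    hq w hw x hx]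

lemma IsCMulti.exists_ratPolyFun_forall_dist_le {γ : Fin d → ℕ∞} {f : (Fin d → ℝ) → ℝ}
    (hf : IsCMulti γ f) (T : Finset (Fin d → ℕ)) (hT : ∀ β ∈ T, ∀ i, (β i : ℕ∞) ≤ γ i) {R : ℝ}
    (hR : 0 ≤ R) {ε : ℝ} (hε : 0 < ε) :
    ∃ q : MvPolynomial (Fin d) ℚ, ∀ β ∈ T, ∀ x ∈ closedBall 0 R,
      dist (multiPartialDeriv β (ratPolyFun q) x) (multiPartialDeriv β f x) ≤ ε := by
  classical
  obtain ⟨F, hF, hFf⟩ := hf.exists_contDiff_dist_le T hT R (half_pos hε)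
  obtain ⟨q, hq⟩ := exists_ratPolyFun_forall_dist_partialDerivList_le_of_contDiff hF
    (T.image multiIndexList) hR (half_pos hε)
  refine ⟨q, fun β hβ x hx => ?_⟩
  have h1 := hq _ (Finset.mem_image_of_mem _ hβ) x hx
  simp only [multiPartialDeriv] at hFf ⊢
  linarith [dist_triangle (partialDerivList (ratPolyFun q) (multiIndexList β) x)
    (partialDerivList F (multiIndexList β) x) (partialDerivList f (multiIndexList β) x),
    hFf β hβ x hx]

lemma IsCMulti.exists_seq_ratPolyFun_tendstoLocallyUniformly {γ : Fin d → ℕ∞}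
    {f : (Fin d → ℝ) → ℝ} (hf : IsCMulti γ f) :
    ∃ q : ℕ → MvPolynomial (Fin d) ℚ,
      ∀ β : Fin d → ℕ, (∀ i, (β i : ℕ∞) ≤ γ i) →
        TendstoLocallyUniformly (fun n => multiPartialDeriv β (ratPolyFun (q n)))
          (multiPartialDeriv β f) atTop := by
  classical
  -- Stage `n` treats the finitely many `β ≤ γ` with entries at most `n`, on the ball of radius `n`,
  -- with error `1 / (n + 1)`.
  choose q hq using fun n : ℕ => hf.exists_ratPolyFun_forall_dist_le
    ((Finset.Iic (fun _ : Fin d => n)).filter fun β => ∀ i, (β i : ℕ∞) ≤ γ i)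
    (fun β hβ => (Finset.mem_filter.1 hβ).2) (Nat.cast_nonneg (α := ℝ) n)
    (Nat.one_div_pos_of_nat (α := ℝ) (n := n))
  refine ⟨q, fun β hβ => tendstoLocallyUniformly_iff_forall_isCompact.2 fun K hK => ?_⟩
  rw [Metric.tendstoUniformlyOn_iff]
  intro ε hε
  obtain ⟨r, hr⟩ := hK.isBounded.subset_closedBall 0
  obtain ⟨N, hN⟩ := exists_nat_ge r
  filter_upwards [eventually_ge_atTop N, eventually_ge_atTop (∑ i, β i),
    tendsto_one_div_add_atTop_nhds_zero_nat.eventually_lt_const hε] with n hnN hnβ hnε x hx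
  rw [dist_comm]
  refine (hq n β ?_ x (closedBall_subset_closedBall ?_ (hr hx))).trans_lt hnε
  · exact Finset.mem_filter.2 ⟨Finset.mem_Iic.2 fun i =>
      (Finset.single_le_sum (f := β) (fun _ _ => Nat.zero_le _) (Finset.mem_univ i)).trans hnβ, hβ⟩
  · exact hN.trans (by exact_mod_cast hnN)

end Polynomials

theorem theorem6p10 (d : ℕ) :
    (∀ (γ : Fin d → ℕ∞) (f : (Fin d → ℝ) → ℝ), IsCMulti γ f →
      ∃ q : ℕ → MvPolynomial (Fin d) ℚ,
        ∀ β : Fin d → ℕ, (∀ i, (β i : ℕ∞) ≤ γ i) →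
          TendstoLocallyUniformly (fun n => multiPartialDeriv β (ratPolyFun (q n)))
            (multiPartialDeriv β f) atTop) ∧
    (∀ f : (Fin d → ℝ) → ℝ, ContDiff ℝ ∞ f →
      ∃ q : ℕ → MvPolynomial (Fin d) ℚ,
        ∀ (K : Set (Fin d → ℝ)), IsCompact K → ∀ β : Fin d → ℕ,
          TendstoUniformlyOn (fun n => multiPartialDeriv β (ratPolyFun (q n)))
            (multiPartialDeriv β f) atTop K) := by
  refine ⟨fun γ f hf => hf.exists_seq_ratPolyFun_tendstoLocallyUniformly, fun f hf => ?_⟩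
  obtain ⟨q, hq⟩ := (hf.isCMulti ⊤).exists_seq_ratPolyFun_tendstoLocallyUniformly
  exact ⟨q, fun K hK β =>
    tendstoLocallyUniformly_iff_forall_isCompact.1 (hq β fun i => le_top) K hK⟩
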